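/- For $n\ge 0$, let $Q_n$ be the graph on $\{0,1\}^n$ in which two vectors are joined when they differ in exactly one coordinate. For $A\subset\{0,1\}^n$ let $\partial A$ be the set of edges of $Q_n$ joining a point of $A$ to a point not in $A$. A subcube of codimension $N$ is a set of the form $\{x\in\{0,1\}^n : x_i=a_i \text{ for all } i\in S\}$ with $S\subset\{1,\dots,n\}$, $|S|=N$ and $a_i\in\{0,1\}$; a subcube is a subcube of some codimension $N\in\{0,\dots,n\}$. (1) There is an absolute constant $c>0$ such that for every real $\epsilon\le c$ the equation $$x\log_2(1/x)-3x=\epsilon$$ has a smallest positive solution $\delta_0(\epsilon)$; if $\epsilon>0$, then $\delta_0(\epsilon)\le 2\epsilon/\log_2(1/\epsilon)$; and for every $n$ and every non-empty $A\subset\{0,1\}^n$ with $$|\partial A|\le |A|\left(\log_2(2^n/|A|)+\epsilon\right)$$ there is a subcube $C$ with $|A\,\Delta\, C|<\delta_0(\epsilon)|A|$. (2) (Conjecture of Bollobás, Leader and Riordan.) For every integer $N\ge 0$ there is a constant $K_N$ such that for all $n\ge N$, all real $\epsilon\ge 0$ and all $A\subset\{0,1\}^n$ with $|A|=2^{n-N}$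 and $$|\partial A|\le(1+\epsilon)|A|\log_2(2^n/|A|)$$ there is a subcube $C$ of codimension $N$ with $|A\,\Delta\, C|\le K_N\,\epsilon\,2^{n-N}$. (3) (Conjecture of Samorodnitsky.) For every $\delta>0$ there is an $a>0$ such that for all $n\ge1$ and all non-empty $A\subset\{0,1\}^n$ with $$|\partial A|\le(1+a/n)|A|\log_2(2^n/|A|)$$ there is a subcube $C$ with $|A\,\Delta\, C|\le\delta|A|$. -/

import Mathlib

open scoped symmDiff

/-- The hypercube graph `Q_n` on `{0,1}^n`: two vectors are joined when they differ in exactly one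
coordinate. -/
def hypercubeGraph (n : ℕ) : SimpleGraph (Fin n → Bool) where
  Adj x y := hammingDist x y = 1
  symm := ⟨fun x y h => by rw [hammingDist_comm]; exact h⟩
  loopless := ⟨fun x h => by simp at h⟩

/-- The edge-boundary of `A`: the edges of `Q_n` joining a point of `A` to a point not in `A`. -/
def edgeBoundary {n : ℕ} (A : Finset (Fin n → Bool)) : Set (Sym2 (Fin n → Bool)) :=
  {e | e ∈ (hypercubeGraph n).edgeSet ∧ ∃ x ∈ A, ∃ y ∉ A, e = s(x, y)}

/-- `C` is a subcube with exactly `N` fixed coordinates (the elements of `S`). -/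
def IsSubcubeOfCodim {n : ℕ} (N : ℕ) (C : Finset (Fin n → Bool)) : Prop :=
  ∃ (S : Finset (Fin n)) (a : Fin n → Bool), S.card = N ∧ ∀ x, x ∈ C ↔ ∀ i ∈ S, x i = a i

/-- `C` is a subcube, of any codimension. -/
def IsSubcube {n : ℕ} (C : Finset (Fin n → Bool)) : Prop :=
  ∃ N : ℕ, IsSubcubeOfCodim N C

/-- The positive solutions of `x log₂(1/x) - 3x = ε`. -/
def deltaZeroSolutions (ε : ℝ) : Set ℝ :=
  {x : ℝ | 0 < x ∧ x * Real.logb 2 (1 / x) - 3 * x = ε}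

/-- `δ₀(ε)`, the smallest positive solution of `x log₂(1/x) - 3x = ε`
(as an infimum; it is the smallest solution exactly when the infimum is attained). -/
noncomputable def deltaZero (ε : ℝ) : ℝ := sInf (deltaZeroSolutions ε)

/-!
The number of edges inside `A` determines its boundary, so the hypothesis says that the excess
`|A| log₂ |A| - 2 e(A)` is at most `ε |A|`, a condition that no longer mentions the dimension.

Cut `A` by a subcube `C` into `A ∩ C` and `A \ C`. A point outside `C` has at most one neighbour in
`C`, so the excess of `A` is at least the sum of those of the two parts plus
`|A| h(p) - 2 |A \ C|`, where `p = |A \ C| / |A|` and `h` is the binary entropy. As `h(p) ≥ 2p` on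
`[0, 1/2]`, with equality only at the ends, this gives both the edge-isoperimetric inequality
(`excess_nonneg`) and a dichotomy (`card_sdiff_subcube_dichotomy`): a subcube containing at least
half of `A` contains nearly all of it or about half of it. For subcubes of codimension one, every
coordinate is thus nearly constant or nearly balanced on `A`. Fixing the nearly constant ones at
their majority values one after the other, the dichotomy shows that the resulting subcube `C`
contains nearly all of `A` (`card_sdiff_subcube_le`).

It remains to see that `C` is not much larger than `A`, which is proved by induction on `|A|`
(`exists_subcube_card_le`). If a coordinate `i` is balanced, one half of `A` in direction `i` has
small relative excess and is therefore close to a subcube `C'`. Almost all neighbours of `A` in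
direction `i` lie in `A`, so all coordinates fixed by `C'`, except perhaps `i`, are nearly constant
on `A`; hence `|C| ≤ 2 |C'|`, which is about `|A|`. The errors do not accumulate, because
`excess_ge_of_subcube` turns this crude bound for `|A ∆ C|` into `|A ∆ C| ≤ ε |A|`. The same
inequality, read precisely, gives `|A ∆ C| < δ₀(ε) |A|`. Both conjectures follow from the bound
`|A ∆ C| ≤ ε |A|`.
-/

section Stability

open Finset

/-! ### The entropy function -/

theorem three_quarters_le_binEntropy_quarter :
    3 / 4 * Real.log 2 ≤ Real.binEntropy (1 / 4) := by
  have h27 : Real.log 27 ≤ Real.log 32 := Real.log_le_log (by norm_num) (by norm_num)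
  have e27 : Real.log 27 = 3 * Real.log 3 := by
    rw [show (27 : ℝ) = 3 ^ 3 by norm_num, Real.log_pow]; norm_num
  have e32 : Real.log 32 = 5 * Real.log 2 := by
    rw [show (32 : ℝ) = 2 ^ 5 by norm_num, Real.log_pow]; norm_num
  have e4 : Real.log 4 = 2 * Real.log 2 := by
    rw [show (4 : ℝ) = 2 ^ 2 by norm_num, Real.log_pow]; norm_num
  have e34 : Real.log (1 - 1 / 4) = Real.log 3 - Real.log 4 := by
    rw [← Real.log_div (by norm_num) (by norm_num)]; norm_num
  rw [Real.binEntropy_eq_negMulLog_add_negMulLog_one_sub, Real.negMulLog, Real.negMulLog, e34,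
    one_div, Real.log_inv]
  linarith

/-- The concave function `binEntropy` lies above its chords between `0`, `1/4` and `1/2`. -/
theorem le_binEntropy {p : ℝ} (h0 : 0 ≤ p) (h1 : p ≤ 1 / 2) :
    (2 * p + min p (1 / 2 - p)) * Real.log 2 ≤ Real.binEntropy p := by
  have hc := Real.strictConcave_binEntropy.concaveOn
  have hq := three_quarters_le_binEntropy_quarter
  have h2 : Real.binEntropy (1 / 2) = Real.log 2 := by
    rw [one_div]; exact Real.binEntropy_two_inv
  rcases le_total p (1 / 4) with h | h
  · have := hc.2 (show (0 : ℝ) ∈ Set.Icc 0 1 by norm_num)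
      (show (1 / 4 : ℝ) ∈ Set.Icc 0 1 by norm_num) (show 0 ≤ 1 - 4 * p by linarith)
      (show 0 ≤ 4 * p by linarith) (by ring)
    simp only [smul_eq_mul, Real.binEntropy_zero] at this
    rw [show (1 - 4 * p) * 0 + 4 * p * (1 / 4) = p by ring] at this
    rw [min_eq_left (by linarith)]
    have := mul_le_mul_of_nonneg_left hq (show 0 ≤ 4 * p by linarith)
    linarith
  · have := hc.2 (show (1 / 4 : ℝ) ∈ Set.Icc 0 1 by norm_num)
      (show (1 / 2 : ℝ) ∈ Set.Icc 0 1 by norm_num) (show 0 ≤ 2 - 4 * p by linarith)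
      (show 0 ≤ 4 * p - 1 by linarith) (by ring)
    simp only [smul_eq_mul, h2] at this
    rw [show (2 - 4 * p) * (1 / 4) + (4 * p - 1) * (1 / 2) = p by ring] at this
    rw [min_eq_right (by linarith)]
    have := mul_le_mul_of_nonneg_left hq (show 0 ≤ 2 - 4 * p by linarith)
    linarith

/-- The unnormalised form of `le_binEntropy`: the entropy, in bits and multiplied by `b + m`, of a
two-valued variable that takes its values with probabilities proportional to `b` and `m`. -/
theorem le_mul_logb_add_sub {b m : ℝ} (hm : 0 ≤ m) (hmb : m ≤ b) :
    2 * m + min m ((b + m) / 2 - m) ≤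
      (b + m) * Real.logb 2 (b + m) - b * Real.logb 2 b - m * Real.logb 2 m := by
  have hl : 0 < Real.log 2 := Real.log_pos (by norm_num)
  rcases hm.eq_or_lt with rfl | hm'
  · simp
  have hb : 0 < b := by linarith
  have ha : 0 < b + m := by linarith
  have key := le_binEntropy (p := m / (b + m)) (by positivity)
    (by rw [div_le_div_iff₀ ha two_pos]; linarith)
  have e1 : 1 - m / (b + m) = b / (b + m) := by field_simp; ring
  rw [Real.binEntropy_eq_negMulLog_add_negMulLog_one_sub, Real.negMulLog, Real.negMulLog, e1,
    Real.log_div hm'.ne' ha.ne', Real.log_div hb.ne' ha.ne'] at key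
  have e2 : (b + m) * (2 * (m / (b + m)) + min (m / (b + m)) (1 / 2 - m / (b + m)))
      = 2 * m + min m ((b + m) / 2 - m) := by
    rw [mul_add, mul_min_of_nonneg _ _ ha.le]
    congr 1
    · field_simp
    · congr 1 <;> field_simp
  rw [← e2]
  simp only [Real.logb]
  rw [← sub_nonneg] at key ⊢
  have := mul_nonneg ha.le key
  have h3 : 0 ≤ ((b + m) * (-(m / (b + m)) * (Real.log m - Real.log (b + m)) +
      -(b / (b + m)) * (Real.log b - Real.log (b + m)) -
      (2 * (m / (b + m)) + min (m / (b + m)) (1 / 2 - m / (b + m))) * Real.log 2)) / Real.log 2 :=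
    div_nonneg this hl.le
  convert h3 using 1
  field_simp
  ring

/-! ### Counting adjacent pairs -/

/-- The neighbour of `x` in the cube in direction `i`. -/
def flipAt {n : ℕ} (i : Fin n) (x : Fin n → Bool) : Fin n → Bool := Function.update x i (!x i)

variable {n : ℕ}

@[simp] theorem flipAt_same (i : Fin n) (x : Fin n → Bool) : flipAt i x i = !x i := by
  simp [flipAt]

theorem flipAt_of_ne {i j : Fin n} (h : j ≠ i) (x : Fin n → Bool) : flipAt i x j = x j := by
  simp [flipAt, h]

@[simp] theorem flipAt_flipAt (i : Fin n) (x : Fin n → Bool) : flipAt i (flipAt i x) = x := by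
  ext j
  by_cases h : j = i
  · subst h; simp
  · simp [flipAt_of_ne h]

theorem flipAt_left_injective (x : Fin n → Bool) : Function.Injective fun i => flipAt i x := by
  intro i j h
  by_contra hne
  have := congrFun h i
  simp [flipAt_of_ne hne] at this

theorem hypercubeGraph_adj_flipAt (i : Fin n) (x : Fin n → Bool) :
    (hypercubeGraph n).Adj x (flipAt i x) := by
  change #{j | x j ≠ flipAt i x j} = 1
  rw [card_eq_one]
  refine ⟨i, ?_⟩
  ext j
  by_cases h : j = i
  · subst h; simp
  · simp [flipAt_of_ne h, h]

/-- The number of pairs consisting of a point of `A` and a neighbour of it in `B`; for `A = B`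
every edge inside `A` counts twice. -/
def adjCount (A B : Finset (Fin n → Bool)) : ℕ := ∑ i, #{x ∈ A | flipAt i x ∈ B}

theorem adjCount_eq_sum (A B : Finset (Fin n → Bool)) :
    adjCount A B = ∑ x ∈ A, #{i | flipAt i x ∈ B} := by
  simp only [adjCount, card_filter]
  exact sum_comm

theorem adjCount_comm (A B : Finset (Fin n → Bool)) : adjCount A B = adjCount B A := by
  refine sum_congr rfl fun i _ => ?_
  refine card_bij' (fun x _ => flipAt i x) (fun x _ => flipAt i x) ?_ ?_ ?_ ?_ <;>
    simp +contextual

theorem adjCount_union_left {A B : Finset (Fin n → Bool)} (h : Disjoint A B)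
    (D : Finset (Fin n → Bool)) : adjCount (A ∪ B) D = adjCount A D + adjCount B D := by
  simp only [adjCount_eq_sum, sum_union h]

theorem adjCount_union_right {A B : Finset (Fin n → Bool)} (h : Disjoint A B)
    (D : Finset (Fin n → Bool)) : adjCount D (A ∪ B) = adjCount D A + adjCount D B := by
  rw [adjCount_comm, adjCount_union_left h, adjCount_comm A, adjCount_comm B]

theorem adjCount_inter_add_sdiff (A C : Finset (Fin n → Bool)) :
    adjCount A A = adjCount (A ∩ C) (A ∩ C) + adjCount (A \ C) (A \ C)
      + 2 * adjCount (A \ C) (A ∩ C) := by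
  have hd : Disjoint (A ∩ C) (A \ C) := disjoint_sdiff_inter A C |>.symm
  have hu : A ∩ C ∪ A \ C = A := by rw [union_comm]; exact sdiff_union_inter A C
  conv_lhs => rw [← hu]
  rw [adjCount_union_left hd, adjCount_union_right hd, adjCount_union_right hd,
    adjCount_comm (A ∩ C) (A \ C)]
  ring

theorem adjCount_compl_le_ncard_edgeBoundary (A : Finset (Fin n → Bool)) :
    adjCount A Aᶜ ≤ (edgeBoundary A).ncard := by
  rw [adjCount_eq_sum, ← card_sigma]
  rw [← Set.ncard_coe_finset]
  refine Set.ncard_le_ncard_of_injOn (fun p => s(p.1, flipAt p.2 p.1)) ?_ ?_ (Set.toFinite _)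
  · rintro ⟨x, i⟩ h
    simp only [coe_sigma, Set.mem_sigma_iff, mem_coe, mem_filter, mem_univ, true_and,
      mem_compl] at h
    exact ⟨hypercubeGraph_adj_flipAt i x, x, h.1, _, h.2, rfl⟩
  · rintro ⟨x, i⟩ h ⟨y, j⟩ h' heq
    simp only [coe_sigma, Set.mem_sigma_iff, mem_coe, mem_filter, mem_univ, true_and,
      mem_compl] at h h'
    rcases Sym2.eq_iff.1 heq with ⟨h1, h2⟩ | ⟨h1, -⟩
    · dsimp only at h1 h2
      subst h1
      rw [flipAt_left_injective x h2]
    · exact absurd (h1 ▸ h.1) h'.2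

theorem adjCount_add_adjCount_compl (A B : Finset (Fin n → Bool)) :
    adjCount A B + adjCount A Bᶜ = n * #A := by
  rw [← adjCount_union_right disjoint_compl_right, union_compl, adjCount]
  simp

/-! ### Subcubes -/

/-- The subcube of the points that agree with `z` on the coordinates in `S`. -/
def subcube (S : Finset (Fin n)) (z : Fin n → Bool) : Finset (Fin n → Bool) :=
  {x | ∀ i ∈ S, x i = z i}

@[simp] theorem mem_subcube {S : Finset (Fin n)} {z x : Fin n → Bool} :
    x ∈ subcube S z ↔ ∀ i ∈ S, x i = z i := by simp [subcube]

theorem isSubcubeOfCodim_subcube (S : Finset (Fin n)) (z : Fin n → Bool) :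
    IsSubcubeOfCodim #S (subcube S z) := ⟨S, z, rfl, fun _ => mem_subcube⟩

theorem card_subcube (S : Finset (Fin n)) (z : Fin n → Bool) : #(subcube S z) = 2 ^ (n - #S) := by
  have : subcube S z = Fintype.piFinset fun i => if i ∈ S then {z i} else univ := by
    ext x
    simp only [mem_subcube, Fintype.mem_piFinset]
    refine forall_congr' fun i => ?_
    by_cases h : i ∈ S <;> simp [h]
  rw [this, Fintype.card_piFinset]
  have : ∀ i, #(if i ∈ S then {z i} else (univ : Finset Bool)) = if i ∈ S then 1 else 2 := by
    intro i; split_ifs <;> simp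
  simp only [this, prod_ite, prod_const_one, one_mul, prod_const]
  congr 1
  have : ({x | x ∉ S} : Finset (Fin n)) = Sᶜ := by ext; simp
  rw [this, card_compl, Fintype.card_fin]

/-- A point outside a subcube has at most one neighbour in it. -/
theorem adjCount_le_card_of_disjoint_subcube {B C : Finset (Fin n → Bool)} {S : Finset (Fin n)}
    {z : Fin n → Bool} (hB : Disjoint B (subcube S z)) (hC : C ⊆ subcube S z) :
    adjCount B C ≤ #B := by
  rw [adjCount_eq_sum, card_eq_sum_ones]
  refine sum_le_sum fun x hx => card_le_one.2 fun i hi j hj => ?_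
  simp only [mem_filter, mem_univ, true_and] at hi hj
  have hx' : x ∉ subcube S z := disjoint_left.1 hB hx
  simp only [mem_subcube, not_forall] at hx'
  obtain ⟨k, hk, hne⟩ := hx'
  have aux : ∀ i, flipAt i x ∈ C → i = k := by
    intro i hi
    by_contra h
    exact hne ((flipAt_of_ne (Ne.symm h) x).symm.trans (mem_subcube.1 (hC hi) k hk))
  rw [aux i hi, aux j hj]

theorem adjCount_subcube {B : Finset (Fin n → Bool)} {S : Finset (Fin n)}
    {z : Fin n → Bool} (hB : B ⊆ subcube S z) :
    adjCount B (subcube S z) = (n - #S) * #B := by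
  rw [adjCount_eq_sum, mul_comm, ← smul_eq_mul, ← sum_const]
  refine sum_congr rfl fun x hx => ?_
  have hx' := mem_subcube.1 (hB hx)
  have : ({i | flipAt i x ∈ subcube S z} : Finset (Fin n)) = Sᶜ := by
    ext i
    simp only [mem_filter, mem_univ, true_and, mem_subcube, mem_compl]
    refine ⟨fun h hi => ?_, fun h j hj => ?_⟩
    · have := h i hi
      rw [flipAt_same, hx' i hi] at this
      simp at this
    · rw [flipAt_of_ne (by rintro rfl; exact h hj), hx' j hj]
  rw [this, card_compl, Fintype.card_fin]

/-! ### The excess of a set -/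

/-- The excess `|A| log₂ |A| - 2 e(A)`, where `e(A)` is the number of edges inside `A`. Since
`n |A| = 2 e(A) + |∂A|`, it equals `|∂A| - |A| log₂ (2 ^ n / |A|)`. -/
noncomputable def excess (A : Finset (Fin n → Bool)) : ℝ :=
  #A * Real.logb 2 #A - adjCount A A

theorem excess_le_of_ncard_edgeBoundary_le {A : Finset (Fin n → Bool)} (hA : A.Nonempty) {ε : ℝ}
    (h : ((edgeBoundary A).ncard : ℝ) ≤ #A * (Real.logb 2 ((2 : ℝ) ^ n / #A) + ε)) :
    excess A ≤ ε * #A := by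
  have ha : (0 : ℝ) < #A := by exact_mod_cast hA.card_pos
  have h1 : (adjCount A Aᶜ : ℝ) ≤ (edgeBoundary A).ncard := by
    exact_mod_cast adjCount_compl_le_ncard_edgeBoundary A
  have h2 : (adjCount A A : ℝ) + adjCount A Aᶜ = n * #A := by
    exact_mod_cast adjCount_add_adjCount_compl A A
  have h3 : Real.logb 2 ((2 : ℝ) ^ n / #A) = n - Real.logb 2 #A := by
    rw [Real.logb_div (by positivity) ha.ne', Real.logb_pow, Real.logb_self_eq_one (by norm_num)]
    ring
  rw [h3] at h
  unfold excess
  linarith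

theorem excess_split (A C : Finset (Fin n → Bool)) :
    excess A = excess (A ∩ C) + excess (A \ C) +
      (#A * Real.logb 2 #A - #(A ∩ C) * Real.logb 2 #(A ∩ C)
        - #(A \ C) * Real.logb 2 #(A \ C)) - 2 * adjCount (A \ C) (A ∩ C) := by
  have : (adjCount A A : ℝ) = adjCount (A ∩ C) (A ∩ C) + adjCount (A \ C) (A \ C)
      + 2 * adjCount (A \ C) (A ∩ C) := by exact_mod_cast adjCount_inter_add_sdiff A C
  unfold excess
  rw [this]
  ring

theorem cast_card_inter_add_card_sdiff (A C : Finset (Fin n → Bool)) :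
    (#A : ℝ) = #(A ∩ C) + #(A \ C) := by
  exact_mod_cast (card_inter_add_card_sdiff A C).symm

theorem excess_ge_of_card_sdiff_le {A : Finset (Fin n → Bool)} (S : Finset (Fin n))
    (z : Fin n → Bool) (h : 2 * #(A \ subcube S z) ≤ #A) :
    excess (A ∩ subcube S z) + excess (A \ subcube S z)
      + min (#(A \ subcube S z) : ℝ) (#A / 2 - #(A \ subcube S z)) ≤ excess A := by
  have hcard := cast_card_inter_add_card_sdiff A (subcube S z)
  have h' : (2 : ℝ) * #(A \ subcube S z) ≤ #A := by exact_mod_cast h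
  have h1 : (adjCount (A \ subcube S z) (A ∩ subcube S z) : ℝ) ≤ #(A \ subcube S z) := by
    exact_mod_cast adjCount_le_card_of_disjoint_subcube sdiff_disjoint inter_subset_right
  have h2 := le_mul_logb_add_sub (b := #(A ∩ subcube S z)) (m := #(A \ subcube S z))
    (by positivity) (by linarith)
  rw [← hcard] at h2
  rw [excess_split A (subcube S z)]
  linarith

/-- A bit that the `i`-th coordinate of at least half of the points of `A` takes. -/
theorem exists_majority (A : Finset (Fin n → Bool)) :
    ∃ z : Fin n → Bool, ∀ i, 2 * #(A \ subcube {i} z) ≤ #A := by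
  have : ∀ i, ∃ b : Bool, 2 * #{x ∈ A | ¬ x i = b} ≤ #A := by
    intro i
    have h := card_filter_add_card_filter_not (s := A) (fun x => x i = true)
    rcases le_total #{x ∈ A | ¬ x i = true} #{x ∈ A | x i = true} with h' | h'
    · exact ⟨true, by omega⟩
    · refine ⟨false, ?_⟩
      have : #{x ∈ A | ¬ x i = false} = #{x ∈ A | x i = true} := by simp
      omega
  choose z hz using this
  refine ⟨z, fun i => ?_⟩
  convert hz i using 3
  ext x; simp

/-- The edge-isoperimetric inequality in the cube. -/
theorem excess_nonneg (A : Finset (Fin n → Bool)) : 0 ≤ excess A := by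
  induction A using Finset.strongInduction with
  | H A ih =>
    by_cases h1 : #A ≤ 1
    · have h0 : adjCount A A = 0 := by
        refine sum_eq_zero fun i _ => card_eq_zero.2 (filter_eq_empty_iff.2 fun x hx hf => ?_)
        have := congrFun (card_le_one.1 h1 _ hf x hx) i
        simp at this
      rw [excess, h0]
      interval_cases #A <;> simp
    · obtain ⟨x, hx, y, hy, hxy⟩ := one_lt_card.1 (not_le.1 h1)
      obtain ⟨i, hi⟩ := Function.ne_iff.1 hxy
      obtain ⟨z, hz⟩ := exists_majority A
      have hC : ∃ u ∈ A, u ∈ subcube {i} z := by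
        by_cases h : x i = z i
        · exact ⟨x, hx, by simpa using h⟩
        · exact ⟨y, hy, by
            simp only [mem_subcube, mem_singleton, forall_eq]
            revert h hi; cases x i <;> cases y i <;> cases z i <;> simp⟩
      have hC' : ∃ u ∈ A, u ∉ subcube {i} z := by
        by_cases h : x i = z i
        · exact ⟨y, hy, by
            simp only [mem_subcube, mem_singleton, forall_eq]
            exact fun h' => hi (h.trans h'.symm)⟩
        · exact ⟨x, hx, by simpa using h⟩
      obtain ⟨u, huA, hu⟩ := hC
      obtain ⟨v, hvA, hv⟩ := hC'
      have hin := ih (A ∩ subcube {i} z)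
        ((ssubset_iff_of_subset inter_subset_left).2 ⟨v, hvA, fun h => hv (mem_inter.1 h).2⟩)
      have hout := ih (A \ subcube {i} z)
        ((ssubset_iff_of_subset sdiff_subset).2 ⟨u, huA, fun h => (mem_sdiff.1 h).2 hu⟩)
      have := excess_ge_of_card_sdiff_le {i} z (hz i)
      have h2 : (2 : ℝ) * #(A \ subcube {i} z) ≤ #A := by exact_mod_cast hz i
      have h3 : 0 ≤ min (#(A \ subcube {i} z) : ℝ) (#A / 2 - #(A \ subcube {i} z)) :=
        le_min (by positivity) (by linarith)
      linarith

/-- If the excess of `A` is small, then a subcube that contains at least half of `A` contains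
either nearly all of `A` or only about half of it. -/
theorem card_sdiff_subcube_dichotomy {A : Finset (Fin n → Bool)} {ε : ℝ}
    (hD : excess A ≤ ε * #A) {S : Finset (Fin n)} {z : Fin n → Bool}
    (h : 2 * #(A \ subcube S z) ≤ #A) :
    (#(A \ subcube S z) : ℝ) ≤ ε * #A ∨ (#A : ℝ) / 2 - #(A \ subcube S z) ≤ ε * #A := by
  have h1 := excess_ge_of_card_sdiff_le S z h
  have h2 := excess_nonneg (A ∩ subcube S z)
  have h3 := excess_nonneg (A \ subcube S z)
  exact min_le_iff.1 (by linarith)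

/-- If each coordinate in `S` is nearly constant on `A`, then they are nearly constant jointly:
when the coordinates are fixed one after the other, the number of points lost changes in small
steps, so that it cannot cross the gap in `card_sdiff_subcube_dichotomy`. -/
theorem card_sdiff_subcube_le {A : Finset (Fin n → Bool)} (hA : A.Nonempty) {ε : ℝ}
    (hε : ε ≤ 1 / 1024) (hD : excess A ≤ ε * #A) {z : Fin n → Bool} (S : Finset (Fin n))
    (hS : ∀ i ∈ S, (#(A \ subcube {i} z) : ℝ) ≤ ε * #A) :
    (#(A \ subcube S z) : ℝ) ≤ ε * #A := by
  have ha : (0 : ℝ) < #A := by exact_mod_cast hA.card_pos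
  have hεa : ε * #A ≤ 1 / 1024 * #A := by gcongr
  induction S using Finset.induction_on with
  | empty =>
    have : A \ subcube ∅ z = ∅ := by ext; simp
    rw [this, card_empty, Nat.cast_zero]
    exact (excess_nonneg A).trans hD
  | insert i S hi ih =>
    have h1 := ih fun j hj => hS j (mem_insert_of_mem hj)
    have h2 := hS i (mem_insert_self i S)
    have hsub : A \ subcube (insert i S) z ⊆ A \ subcube S z ∪ A \ subcube {i} z := by
      intro x hx
      simp only [mem_sdiff, mem_subcube, mem_insert, forall_eq_or_imp, mem_union, mem_singleton,
        forall_eq] at hx ⊢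
      tauto
    have h3 : (#(A \ subcube (insert i S) z) : ℝ)
        ≤ #(A \ subcube S z) + #(A \ subcube {i} z) := by
      exact_mod_cast (card_le_card hsub).trans (card_union_le _ _)
    have h4 : 2 * #(A \ subcube (insert i S) z) ≤ #A := by
      have : (2 : ℝ) * #(A \ subcube (insert i S) z) ≤ #A := by linarith
      exact_mod_cast this
    rcases card_sdiff_subcube_dichotomy hD h4 with h | h
    · exact h
    · linarith

/-! ### Distance to a subcube -/

/-- The logarithmic lower bound for the excess. The term in `A \ C` comes from the points of `A`
outside `C` having at most one neighbour each in `C`, the term in `C \ A` from the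
edge-isoperimetric inequality for `C \ A` inside `C`. -/
theorem excess_ge_of_subcube {A : Finset (Fin n → Bool)} {S : Finset (Fin n)} {z : Fin n → Bool}
    (hb : 0 < #(A ∩ subcube S z)) :
    (#(A \ subcube S z) : ℝ) * (Real.logb 2 (#A / #(A \ subcube S z)) - 2)
      + #(subcube S z \ A) * (Real.logb 2 (#(A ∩ subcube S z) / #(subcube S z \ A)) - 2)
      ≤ excess A := by
  have hcard := cast_card_inter_add_card_sdiff A (subcube S z)
  have hcardC := cast_card_inter_add_card_sdiff (subcube S z) A
  rw [inter_comm] at hcardC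
  have hadj : (adjCount (A \ subcube S z) (A ∩ subcube S z) : ℝ) ≤ #(A \ subcube S z) := by
    exact_mod_cast adjCount_le_card_of_disjoint_subcube sdiff_disjoint inter_subset_right
  have hsplit := excess_split A (subcube S z)
  have hout := excess_nonneg (A \ subcube S z)
  have hin : excess (A ∩ subcube S z) = #(A ∩ subcube S z) * Real.logb 2 #(A ∩ subcube S z)
    - adjCount (A ∩ subcube S z) (A ∩ subcube S z) := rfl
  have hgap : 0 ≤ #(subcube S z \ A) * Real.logb 2 #(subcube S z \ A)
    - adjCount (subcube S z \ A) (subcube S z \ A) := excess_nonneg (subcube S z \ A)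
  have hd : Disjoint (A ∩ subcube S z) (subcube S z \ A) :=
    disjoint_sdiff.mono_left inter_subset_left
  have hu : A ∩ subcube S z ∪ subcube S z \ A = subcube S z := by ext; simp; tauto
  have e1 := adjCount_subcube (B := A ∩ subcube S z) (S := S) (z := z) inter_subset_right
  have e2 := adjCount_subcube (B := subcube S z \ A) (S := S) (z := z) sdiff_subset
  have u1 := adjCount_union_right hd (A ∩ subcube S z)
  have u2 := adjCount_union_right hd (subcube S z \ A)
  rw [hu, e1] at u1
  rw [hu, e2, adjCount_comm _ (A ∩ subcube S z)] at u2
  have u1' : ((n - #S : ℕ) : ℝ) * #(A ∩ subcube S z) =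
    adjCount (A ∩ subcube S z) (A ∩ subcube S z) +
      adjCount (A ∩ subcube S z) (subcube S z \ A) := by exact_mod_cast u1
  have u2' : ((n - #S : ℕ) : ℝ) * #(subcube S z \ A) =
    adjCount (A ∩ subcube S z) (subcube S z \ A) +
      adjCount (subcube S z \ A) (subcube S z \ A) := by exact_mod_cast u2
  have ht : ((n - #S : ℕ) : ℝ) = Real.logb 2 #(subcube S z) := by
    rw [card_subcube]; push_cast
    rw [Real.logb_pow, Real.logb_self_eq_one (by norm_num), mul_one]
  rw [ht, hcardC] at u1' u2'
  have hb' : (0 : ℝ) < #(A ∩ subcube S z) := by exact_mod_cast hb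
  have hm0 : (0 : ℝ) ≤ #(subcube S z \ A) := by positivity
  have hq0 : (0 : ℝ) ≤ #(A \ subcube S z) := by positivity
  rw [hcard] at hsplit ⊢
  generalize (#(A ∩ subcube S z) : ℝ) = b at *
  generalize (#(subcube S z \ A) : ℝ) = m at *
  generalize (#(A \ subcube S z) : ℝ) = q at *
  have f1 : q * Real.logb 2 ((b + q) / q) = q * Real.logb 2 (b + q) - q * Real.logb 2 q := by
    rcases hq0.eq_or_lt with rfl | h
    · simp
    · rw [Real.logb_div (by positivity) h.ne', mul_sub]
  have f2 : m * Real.logb 2 (b / m) ≤ m * Real.logb 2 (b + m) - m * Real.logb 2 m := by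
    rcases hm0.eq_or_lt with rfl | h
    · simp
    · rw [Real.logb_div hb'.ne' h.ne', mul_sub]
      have : Real.logb 2 b ≤ Real.logb 2 (b + m) :=
        Real.logb_le_logb_of_le (by norm_num) hb' (by linarith)
      nlinarith
  have f3 : b * Real.logb 2 b ≤ b * Real.logb 2 (b + q) := by
    gcongr
    · norm_num
    · linarith
  have f4 : b * Real.logb 2 (b + m) ≤ b * Real.logb 2 b + 2 * m := by
    have hl : 1 / 2 < Real.log 2 := by linarith [Real.log_two_gt_d9]
    have h1 : Real.log ((b + m) / b) ≤ (b + m) / b - 1 := Real.log_le_sub_one_of_pos (by positivity)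
    rw [Real.log_div (by positivity) hb'.ne', show (b + m) / b - 1 = m / b by field_simp; ring] at h1
    have h2 : b * (Real.log (b + m) - Real.log b) ≤ m := by
      calc _ ≤ b * (m / b) := by gcongr
        _ = m := by field_simp
    rw [← sub_le_iff_le_add', ← mul_sub, Real.logb, Real.logb, ← sub_div, ← mul_div_assoc,
      div_le_iff₀ (by linarith)]
    nlinarith
  linarith

/-- The logarithmic lower bound gives a linear one once the distance to the subcube is small. -/
theorem card_sdiff_add_card_sdiff_le_excess {A : Finset (Fin n → Bool)} {S : Finset (Fin n)}
    {z : Fin n → Bool} (hA : A.Nonempty) (hq : (#(A \ subcube S z) : ℝ) ≤ #A / 128)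
    (hm : (#(subcube S z \ A) : ℝ) ≤ #A / 128) :
    (#(A \ subcube S z) : ℝ) + #(subcube S z \ A) ≤ excess A := by
  have ha : (0 : ℝ) < #A := by exact_mod_cast hA.card_pos
  have hcard := cast_card_inter_add_card_sdiff A (subcube S z)
  have hb : (0 : ℝ) < #(A ∩ subcube S z) := by linarith
  have h := excess_ge_of_subcube (A := A) (S := S) (z := z) (by exact_mod_cast hb)
  have aux : ∀ {u v : ℝ}, 0 ≤ u → 8 * u ≤ v → u ≤ u * (Real.logb 2 (v / u) - 2) := by
    intro u v hu huv
    rcases hu.eq_or_lt with rfl | hu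
    · simp
    · have : (3 : ℝ) ≤ Real.logb 2 (v / u) := by
        rw [Real.le_logb_iff_rpow_le (by norm_num) (by have : 0 < v := by linarith
                                                       positivity), le_div_iff₀ hu]
        norm_num
        exact huv
      nlinarith
  have h1 := aux (Nat.cast_nonneg #(A \ subcube S z)) (v := #A) (by linarith)
  have h2 := aux (Nat.cast_nonneg #(subcube S z \ A)) (v := #(A ∩ subcube S z)) (by linarith)
  linarith

/-- If half of the points of `A` lie on each side of direction `i`, up to a small error, then
nearly all neighbours in direction `i` of points of `A` belong to `A`, and one of the two halves
of `A` inherits the bound on the excess. -/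
theorem exists_half_excess_le {A : Finset (Fin n → Bool)} {ε : ℝ}
    (hD : excess A ≤ ε * #A) {z : Fin n → Bool} {i : Fin n}
    (h : 2 * #(A \ subcube {i} z) ≤ #A) (h' : (#A : ℝ) / 2 - #(A \ subcube {i} z) ≤ ε * #A) :
    (#{x ∈ A | flipAt i x ∉ A} : ℝ) ≤ 3 * ε * #A ∧
      ∃ β : Bool, excess {x ∈ A | x i = β} ≤ ε * #{x ∈ A | x i = β} ∧
        (#{x ∈ A | x i = β} : ℝ) ≤ (1 / 2 + ε) * #A := by
  have hin : A ∩ subcube {i} z = {x ∈ A | x i = z i} := by ext; simp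
  have hout : A \ subcube {i} z = {x ∈ A | x i = !z i} := by
    ext x; simp [Bool.eq_not_iff]
  have hcard := cast_card_inter_add_card_sdiff A (subcube {i} z)
  have hsplit := excess_split A (subcube {i} z)
  have hR : (2 : ℝ) * #(A \ subcube {i} z) ≤ #A := by exact_mod_cast h
  have hent := le_mul_logb_add_sub (b := #(A ∩ subcube {i} z)) (m := #(A \ subcube {i} z))
    (by positivity) (by linarith)
  rw [← hcard] at hent
  have hmin : 0 ≤ min (#(A \ subcube {i} z) : ℝ) (#A / 2 - #(A \ subcube {i} z)) :=
    le_min (by positivity) (by linarith)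
  have hadj : (adjCount (A \ subcube {i} z) (A ∩ subcube {i} z) : ℝ) ≤ #(A \ subcube {i} z) := by
    exact_mod_cast adjCount_le_card_of_disjoint_subcube sdiff_disjoint inter_subset_right
  have hnn1 := excess_nonneg (A ∩ subcube {i} z)
  have hnn2 := excess_nonneg (A \ subcube {i} z)
  constructor
  · -- an edge between the two halves has direction `i`
    have hdir : ∀ (B B' : Finset (Fin n → Bool)) (β : Bool), (∀ x ∈ B, x ∈ A ∧ x i = β) →
        (∀ x ∈ B', x ∈ A ∧ x i = !β) →
        adjCount B B' ≤ #{x ∈ A | flipAt i x ∈ A ∧ x i = β} := by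
      intro B B' β hB hB'
      rw [adjCount, sum_eq_single i]
      · refine card_le_card fun x hx => ?_
        simp only [mem_filter] at hx ⊢
        exact ⟨(hB x hx.1).1, (hB' _ hx.2).1, (hB x hx.1).2⟩
      · intro j _ hj
        refine card_eq_zero.2 (filter_eq_empty_iff.2 fun x hx hf => ?_)
        have h1 := (hB' _ hf).2
        rw [flipAt_of_ne hj.symm, (hB x hx).2] at h1
        simp at h1
      · simp
    have h1 := hdir (A ∩ subcube {i} z) (A \ subcube {i} z) (z i)
      (fun x hx => by rw [hin] at hx; simpa using hx)
      (fun x hx => by rw [hout] at hx; simpa using hx)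
    have h2 := hdir (A \ subcube {i} z) (A ∩ subcube {i} z) (!z i)
      (fun x hx => by rw [hout] at hx; simpa using hx)
      (fun x hx => by rw [hin] at hx; simpa using hx)
    rw [adjCount_comm] at h1
    have h3 : #{x ∈ A | flipAt i x ∈ A ∧ x i = z i} + #{x ∈ A | flipAt i x ∈ A ∧ x i = !z i}
        = #{x ∈ A | flipAt i x ∈ A} := by
      rw [← card_filter_add_card_filter_not (s := {x ∈ A | flipAt i x ∈ A}) (fun x => x i = z i),
        filter_filter, filter_filter]
      simp only [Bool.eq_not_iff, ne_eq]
    have h4 := card_filter_add_card_filter_not (s := A) (fun x => flipAt i x ∈ A)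
    have h5 : (2 * adjCount (A \ subcube {i} z) (A ∩ subcube {i} z) : ℝ)
        + #{x ∈ A | flipAt i x ∉ A} ≤ #A := by
      exact_mod_cast (by omega : 2 * adjCount (A \ subcube {i} z) (A ∩ subcube {i} z)
        + #{x ∈ A | flipAt i x ∉ A} ≤ #A)
    linarith
  · by_cases hc : excess (A ∩ subcube {i} z) ≤ ε * #(A ∩ subcube {i} z)
    · refine ⟨z i, ?_⟩
      rw [← hin]
      exact ⟨hc, by linarith⟩
    · refine ⟨!z i, ?_⟩
      rw [← hout]
      constructor
      · have : ε * #A = ε * #(A ∩ subcube {i} z) + ε * #(A \ subcube {i} z) := by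
          rw [hcard, mul_add]
        linarith
      · have : 0 ≤ ε * #A := by linarith [excess_nonneg A]
        linarith

/-- Suppose that nearly every neighbour in direction `i` of a point of `A` is in `A`. If one half
of `A` in direction `i` is close to a subcube, then the whole of `A` nearly satisfies the
constraints of that subcube in the other directions. -/
theorem card_filter_ne_le {A C : Finset (Fin n → Bool)} {i k : Fin n} (hk : k ≠ i) {β b : Bool}
    (hC : ∀ x ∈ C, x k = b) :
    #{x ∈ A | x k ≠ b} ≤ 2 * #({x ∈ A | x i = β} \ C) + #{x ∈ A | flipAt i x ∉ A} := by
  have hT : #{x ∈ A | x i = β ∧ x k ≠ b} ≤ #({x ∈ A | x i = β} \ C) := by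
    refine card_le_card fun x hx => ?_
    simp only [mem_filter, mem_sdiff] at hx ⊢
    exact ⟨⟨hx.1, hx.2.1⟩, fun h => hx.2.2 (hC x h)⟩
  have hsub : {x ∈ A | x k ≠ b} ⊆ ({x ∈ A | x i = β ∧ x k ≠ b} ∪
      {x ∈ A | x i = β ∧ x k ≠ b}.image (flipAt i)) ∪ {x ∈ A | flipAt i x ∉ A} := by
    intro x hx
    simp only [mem_filter, mem_union, mem_image] at hx ⊢
    by_cases h1 : x i = β
    · exact Or.inl (Or.inl ⟨hx.1, h1, hx.2⟩)
    by_cases h2 : flipAt i x ∈ A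
    · refine Or.inl (Or.inr ⟨flipAt i x, ⟨h2, ?_, ?_⟩, flipAt_flipAt i x⟩)
      · rw [flipAt_same]; revert h1; cases x i <;> cases β <;> simp
      · rw [flipAt_of_ne hk]; exact hx.2
    · exact Or.inr ⟨hx.1, h2⟩
  have h1 := card_le_card hsub
  have h2 := card_union_le ({x ∈ A | x i = β ∧ x k ≠ b} ∪
      {x ∈ A | x i = β ∧ x k ≠ b}.image (flipAt i)) {x ∈ A | flipAt i x ∉ A}
  have h3 := card_union_le {x ∈ A | x i = β ∧ x k ≠ b}
    ({x ∈ A | x i = β ∧ x k ≠ b}.image (flipAt i))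
  have h4 : #({x ∈ A | x i = β ∧ x k ≠ b}.image (flipAt i)) ≤ _ := card_image_le
  omega

theorem card_subcube_le_two_mul {S S' : Finset (Fin n)} {i : Fin n} (h : S'.erase i ⊆ S)
    (z z' : Fin n → Bool) : #(subcube S z) ≤ 2 * #(subcube S' z') := by
  rw [card_subcube, card_subcube, ← pow_succ']
  refine Nat.pow_le_pow_right two_pos ?_
  have h1 := card_le_card h
  have h2 := pred_card_le_card_erase (s := S') (a := i)
  omega

/-- A set with small excess is close to a subcube. The subcube fixes the coordinates that are
nearly constant on `A`. -/
theorem exists_subcube_card_le {ε : ℝ} (hε : ε ≤ 1 / 1024) (A : Finset (Fin n → Bool))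
    (hA : A.Nonempty) (hD : excess A ≤ ε * #A) :
    ∃ (S : Finset (Fin n)) (z : Fin n → Bool),
      (#(A \ subcube S z) : ℝ) + #(subcube S z \ A) ≤ ε * #A := by
  induction A using Finset.strongInduction with
  | H A ih =>
    have ha : (0 : ℝ) < #A := by exact_mod_cast hA.card_pos
    have hεa : ε * #A ≤ 1 / 1024 * #A := by gcongr
    have hεa0 : 0 ≤ ε * #A := (excess_nonneg A).trans hD
    have hε0 : 0 ≤ ε := nonneg_of_mul_nonneg_left hεa0 ha
    obtain ⟨z, hz⟩ := exists_majority A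
    obtain ⟨S, hS⟩ : ∃ S : Finset (Fin n), ∀ i, i ∈ S ↔ (#(A \ subcube {i} z) : ℝ) ≤ ε * #A := by
      classical
      exact ⟨({i | (#(A \ subcube {i} z) : ℝ) ≤ ε * #A} : Finset _), by simp⟩
    have hq := card_sdiff_subcube_le hA hε hD S fun i hi => (hS i).1 hi
    have hcard := cast_card_inter_add_card_sdiff A (subcube S z)
    have hcardC := cast_card_inter_add_card_sdiff (subcube S z) A
    rw [inter_comm] at hcardC
    -- the crude bound `|C \ A| ≤ |A| / 128` suffices
    refine ⟨S, z, (card_sdiff_add_card_sdiff_le_excess hA (by linarith) ?_).trans hD⟩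
    by_cases hT : ∃ i, i ∉ S
    · obtain ⟨i, hi⟩ := hT
      have hi' := (card_sdiff_subcube_dichotomy hD (hz i)).resolve_left fun h => hi ((hS i).2 h)
      obtain ⟨hflip, β, hβ, hβcard⟩ := exists_half_excess_le hD (hz i) hi'
      have hε2 : (1 / 2 + ε) * (#A : ℝ) ≤ (1 / 2 + 1 / 1024) * #A := by gcongr
      have hβne : ({x ∈ A | x i = β} : Finset _).Nonempty := by
        rw [← card_pos]
        by_contra h0
        have hall : ({x ∈ A | x i = β} : Finset _) = ∅ := card_eq_zero.1 (by omega)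
        have hfl : ({x ∈ A | flipAt i x ∉ A} : Finset _) = A := by
          refine filter_true_of_mem fun x hx hx' => ?_
          have h1 : x i ≠ β := filter_eq_empty_iff.1 hall hx
          have h2 : flipAt i x i ≠ β := filter_eq_empty_iff.1 hall hx'
          rw [flipAt_same] at h2
          revert h1 h2; cases x i <;> cases β <;> simp
        rw [hfl] at hflip
        linarith
      obtain ⟨S', z', h'⟩ := ih {x ∈ A | x i = β}
        ((filter_subset _ _).ssubset_of_ne fun h => by rw [h] at hβcard; linarith) hβne hβ
      have hεβ : ε * #{x ∈ A | x i = β} ≤ ε * #A := by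
        gcongr; exact filter_subset _ _
      have hq' : (0 : ℝ) ≤ #({x ∈ A | x i = β} \ subcube S' z') := by positivity
      have hm' : (0 : ℝ) ≤ #(subcube S' z' \ {x ∈ A | x i = β}) := by positivity
      -- a coordinate fixed by the subcube near the half of `A` is nearly constant on `A`
      have hsub : S'.erase i ⊆ S := by
        intro k hk
        obtain ⟨hki, hkS'⟩ := mem_erase.1 hk
        have h1 : (#{x ∈ A | x k ≠ z' k} : ℝ) ≤ 2 * #({x ∈ A | x i = β} \ subcube S' z')
            + #{x ∈ A | flipAt i x ∉ A} := by
          exact_mod_cast card_filter_ne_le hki fun x hx => mem_subcube.1 hx k hkS'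
        have hzk : (2 : ℝ) * #(A \ subcube {k} z) ≤ #A := by exact_mod_cast hz k
        have h2 : A \ subcube {k} z = {x ∈ A | x k ≠ z k} := by ext; simp
        have hzz : z k = z' k := by
          by_contra hne
          have h3 : A \ subcube {k} z = {x ∈ A | ¬ x k ≠ z' k} := by
            rw [h2]
            refine filter_congr fun x _ => ?_
            revert hne; cases x k <;> cases z k <;> cases z' k <;> simp
          have h4 : (#{x ∈ A | x k ≠ z' k} : ℝ) + #{x ∈ A | ¬ x k ≠ z' k} = #A := by
            exact_mod_cast card_filter_add_card_filter_not (s := A) (fun x => x k ≠ z' k)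
          rw [h3] at hzk
          linarith
        rw [← hzz, ← h2] at h1
        exact (hS k).2 ((card_sdiff_subcube_dichotomy hD (hz k)).resolve_right
          fun h => by linarith)
      have hC : (#(subcube S z) : ℝ) ≤ 2 * #(subcube S' z') := by
        exact_mod_cast card_subcube_le_two_mul hsub z z'
      have hC' : (#(subcube S' z') : ℝ) ≤ #{x ∈ A | x i = β}
          + #(subcube S' z' \ {x ∈ A | x i = β}) := by
        rw [cast_card_inter_add_card_sdiff (subcube S' z') {x ∈ A | x i = β}]
        gcongr
        exact inter_subset_right
      linarith
    · -- every coordinate is nearly constant on `A`, and the subcube is a point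
      push Not at hT
      have h1 : #(subcube S z) = 1 := by
        rw [card_subcube, show S = univ from eq_univ_iff_forall.2 hT, card_univ, Fintype.card_fin,
          Nat.sub_self, pow_zero]
      have h2 : 0 < #(A ∩ subcube S z) := by
        have : (0 : ℝ) < #(A ∩ subcube S z) := by linarith
        exact_mod_cast this
      have h3 : (1 : ℝ) ≤ #(A ∩ subcube S z) := by exact_mod_cast h2
      rw [h1, Nat.cast_one] at hcardC
      linarith

theorem card_symmDiff {A C : Finset (Fin n → Bool)} : (#(A ∆ C) : ℝ) = #(A \ C) + #(C \ A) := by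
  rw [symmDiff_def, sup_eq_union, card_union_of_disjoint disjoint_sdiff_sdiff]
  push_cast; rfl

/-! ### The equation for `deltaZero` -/

theorem continuous_mul_logb_one_div_sub :
    Continuous fun x : ℝ => x * Real.logb 2 (1 / x) - 3 * x := by
  have : (fun x : ℝ => x * Real.logb 2 (1 / x) - 3 * x)
      = fun x => Real.negMulLog x / Real.log 2 - 3 * x := by
    funext x
    rw [one_div, Real.logb_inv, Real.logb, Real.negMulLog]
    ring
  rw [this]
  have := Real.continuous_negMulLog
  fun_prop

/-- Away from `ε = 0` the infimum is attained, since the function vanishes at `0`. -/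
theorem isLeast_deltaZero_of_nonempty {ε : ℝ} (hε : ε ≠ 0)
    (h : (deltaZeroSolutions ε).Nonempty) : IsLeast (deltaZeroSolutions ε) (deltaZero ε) := by
  have heq : deltaZeroSolutions ε
      = Set.Ici 0 ∩ (fun x : ℝ => x * Real.logb 2 (1 / x) - 3 * x) ⁻¹' {ε} := by
    ext x
    simp only [deltaZeroSolutions, Set.mem_ofPred_eq, Set.mem_inter_iff, Set.mem_Ici,
      Set.mem_preimage, Set.mem_singleton_iff]
    refine ⟨fun h => ⟨h.1.le, h.2⟩, fun h => ⟨h.1.lt_of_ne ?_, h.2⟩⟩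
    rintro rfl
    simp at h
    exact hε h.symm
  have hcl : IsClosed (deltaZeroSolutions ε) := by
    rw [heq]
    exact isClosed_Ici.inter (isClosed_singleton.preimage continuous_mul_logb_one_div_sub)
  have hbdd : BddBelow (deltaZeroSolutions ε) := ⟨0, fun x hx => hx.1.le⟩
  exact ⟨hcl.csInf_mem h hbdd, fun x hx => csInf_le hbdd hx⟩

theorem deltaZeroSolutions_zero : deltaZeroSolutions 0 = {1 / 8} := by
  ext x
  simp only [deltaZeroSolutions, Set.mem_ofPred_eq, Set.mem_singleton_iff]
  constructor
  · rintro ⟨hx, h⟩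
    have h3 : Real.logb 2 (1 / x) = 3 := by
      have : x * (Real.logb 2 (1 / x) - 3) = 0 := by linarith
      rcases mul_eq_zero.1 this with h | h <;> linarith
    rw [Real.logb_eq_iff_rpow_eq (by norm_num) (by norm_num) (by positivity)] at h3
    norm_num at h3
    rw [← inv_inv x, ← h3]
    norm_num
  · rintro rfl
    have : Real.logb 2 8 = 3 := by
      rw [Real.logb_eq_iff_rpow_eq (by norm_num) (by norm_num) (by norm_num)]; norm_num
    norm_num [this]

theorem deltaZeroSolutions_nonempty_of_neg {ε : ℝ} (hε : ε < 0) :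
    (deltaZeroSolutions ε).Nonempty := by
  have h8 : (1 / 8 : ℝ) ∈ deltaZeroSolutions 0 := by rw [deltaZeroSolutions_zero]; rfl
  set M := max 1 (-ε) with hM
  have hM1 : 1 ≤ M := le_max_left _ _
  have hM2 : -ε ≤ M := le_max_right _ _
  have hfM : M * Real.logb 2 (1 / M) - 3 * M ≤ ε := by
    have : 0 ≤ Real.logb 2 M := Real.logb_nonneg (by norm_num) hM1
    rw [one_div, Real.logb_inv]
    nlinarith
  obtain ⟨x, hx, hfx⟩ := intermediate_value_Icc' (show (1 / 8 : ℝ) ≤ M by linarith)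
    continuous_mul_logb_one_div_sub.continuousOn ⟨hfM, h8.2 ▸ hε.le⟩
  exact ⟨x, by linarith [hx.1], hfx⟩

theorem exists_mem_deltaZeroSolutions_le {ε : ℝ} (h0 : 0 < ε) (hε : ε ≤ 1 / 1024) :
    ∃ x ∈ deltaZeroSolutions ε, x ≤ 2 * ε / Real.logb 2 (1 / ε) := by
  have hL : 10 ≤ Real.logb 2 (1 / ε) := by
    rw [Real.le_logb_iff_rpow_le (by norm_num) (by positivity), le_div_iff₀ h0]
    norm_num
    linarith
  set L := Real.logb 2 (1 / ε) with hLdef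
  have hL2 : 3 ≤ Real.logb 2 L := by
    rw [Real.le_logb_iff_rpow_le (by norm_num) (by linarith)]
    exact le_trans (by norm_num) hL
  have hx0 : 0 < 2 * ε / L := by positivity
  have hlog : Real.logb 2 (1 / (2 * ε / L)) = L + Real.logb 2 L - 1 := by
    have : 1 / (2 * ε / L) = 1 / ε * L / 2 := by field_simp
    rw [this, Real.logb_div (by positivity) (by norm_num), Real.logb_mul (by positivity)
      (by positivity), Real.logb_self_eq_one (by norm_num)]
  have hf : ε ≤ 2 * ε / L * Real.logb 2 (1 / (2 * ε / L)) - 3 * (2 * ε / L) := by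
    rw [hlog, ← sub_nonneg]
    have : 2 * ε / L * (L + Real.logb 2 L - 1) - 3 * (2 * ε / L) - ε
        = ε / L * (L + 2 * Real.logb 2 L - 8) := by field_simp; ring
    rw [this]
    exact mul_nonneg (by positivity) (by linarith)
  obtain ⟨x, hx, hfx⟩ := intermediate_value_Icc hx0.le
    continuous_mul_logb_one_div_sub.continuousOn ⟨by simpa using h0.le, hf⟩
  refine ⟨x, ⟨hx.1.lt_of_ne ?_, hfx⟩, hx.2⟩
  rintro rfl
  simp at hfx
  exact h0.ne hfx

theorem isLeast_deltaZero {ε : ℝ} (hε : ε ≤ 1 / 1024) :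
    IsLeast (deltaZeroSolutions ε) (deltaZero ε) := by
  rcases lt_trichotomy ε 0 with h | rfl | h
  · exact isLeast_deltaZero_of_nonempty h.ne (deltaZeroSolutions_nonempty_of_neg h)
  · rw [deltaZero, deltaZeroSolutions_zero, csInf_singleton]
    exact isLeast_singleton
  · obtain ⟨x, hx, -⟩ := exists_mem_deltaZeroSolutions_le h hε
    exact isLeast_deltaZero_of_nonempty h.ne' ⟨x, hx⟩

theorem mul_logb_one_div_sub_mono {u v : ℝ} (hu : 0 < u) (huv : u ≤ v) (hv : v ≤ 1 / 32) :
    u * Real.logb 2 (1 / u) - 3 * u ≤ v * Real.logb 2 (1 / v) - 3 * v := by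
  have hv0 : 0 < v := hu.trans_le huv
  have h5 : 5 ≤ Real.logb 2 (1 / v) := by
    rw [Real.le_logb_iff_rpow_le (by norm_num) (by positivity), le_div_iff₀ hv0]
    norm_num
    linarith
  have hl : 1 / 2 < Real.log 2 := by linarith [Real.log_two_gt_d9]
  have h1 : u * Real.logb 2 (v / u) ≤ 2 * (v - u) := by
    have h2 : Real.log (v / u) ≤ v / u - 1 := Real.log_le_sub_one_of_pos (by positivity)
    have h3 : u * Real.log (v / u) ≤ v - u := by
      calc _ ≤ u * (v / u - 1) := by gcongr
        _ = v - u := by field_simp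
    rw [Real.logb, ← mul_div_assoc, div_le_iff₀ (by linarith)]
    nlinarith
  have h4 : Real.logb 2 (1 / u) = Real.logb 2 (1 / v) + Real.logb 2 (v / u) := by
    rw [← Real.logb_mul (by positivity) (by positivity)]
    congr 1
    field_simp
  rw [h4]
  nlinarith

/-- The function increases on `(0, 1 / 32]`, so there a value smaller than `ε` is only taken before
the first solution. -/
theorem lt_deltaZero {ε x : ℝ} (hε : ε ≤ 1 / 1024) (hx : x ≤ ε)
    (hf : 0 < x → x * Real.logb 2 (1 / x) - 3 * x < ε) : x < deltaZero ε := by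
  have hd := (isLeast_deltaZero hε).1
  by_contra! h
  have hx0 : 0 < x := hd.1.trans_le h
  have := mul_logb_one_div_sub_mono hd.1 h (by linarith)
  rw [hd.2] at this
  linarith [hf hx0]

/-! ### Sharp distance to a subcube -/

/-- As `x ↦ x log₂ (1 / x)` is subadditive, the bounds for the numbers `q` of deleted points and
`m` of added points combine to one for their total. -/
theorem mul_logb_div_add_lt {a q m E : ℝ} (ha : 0 < a) (hq : 0 ≤ q) (hm : 0 ≤ m)
    (hqm : 0 < q + m) (hq2 : q < a / 2)
    (h : q * (Real.logb 2 (a / q) - 2) + m * (Real.logb 2 ((a - q) / m) - 2) ≤ E) :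
    (q + m) * Real.logb 2 (a / (q + m)) - 3 * (q + m) < E := by
  have mono : ∀ {u : ℝ}, 0 ≤ u → u ≤ q + m →
      u * Real.logb 2 (a / (q + m)) ≤ u * Real.logb 2 (a / u) := by
    intro u hu hu'
    rcases hu.eq_or_lt with rfl | hu
    · simp
    · gcongr
      norm_num
  have h1 := mono hq (by linarith)
  have h2 := mono hm (by linarith)
  rcases hm.eq_or_lt with rfl | hm0
  · have : 0 < q := by linarith
    simp only [add_zero, zero_mul] at *
    linarith
  · have h3 : Real.logb 2 (a / m) - 1 < Real.logb 2 ((a - q) / m) := by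
      rw [← Real.logb_self_eq_one (b := 2) (by norm_num),
        ← Real.logb_div (by positivity) (by norm_num)]
      refine Real.logb_lt_logb (by norm_num) (by positivity) ?_
      rw [div_right_comm]
      gcongr
      linarith
    nlinarith

theorem exists_subcube_card_lt_deltaZero {ε : ℝ} (hε : ε ≤ 1 / 1024) {A : Finset (Fin n → Bool)}
    (hA : A.Nonempty) (hD : excess A ≤ ε * #A) :
    ∃ C, IsSubcube C ∧ (#(A ∆ C) : ℝ) < deltaZero ε * #A := by
  obtain ⟨S, z, h⟩ := exists_subcube_card_le hε A hA hD
  refine ⟨subcube S z, ⟨_, isSubcubeOfCodim_subcube S z⟩, ?_⟩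
  have ha : (0 : ℝ) < #A := by exact_mod_cast hA.card_pos
  have hεa : ε * #A ≤ 1 / 1024 * #A := by gcongr
  have hq : (0 : ℝ) ≤ #(A \ subcube S z) := by positivity
  have hm : (0 : ℝ) ≤ #(subcube S z \ A) := by positivity
  have hcard := cast_card_inter_add_card_sdiff A (subcube S z)
  have hb : (0 : ℝ) < #(A ∩ subcube S z) := by linarith
  have hL := (excess_ge_of_subcube (by exact_mod_cast hb)).trans hD
  rw [show (#(A ∩ subcube S z) : ℝ) = #A - #(A \ subcube S z) by linarith] at hL
  rw [card_symmDiff, ← div_lt_iff₀ ha]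
  refine lt_deltaZero hε ((div_le_iff₀ ha).2 h) fun hpos => ?_
  have hpos' := (div_pos_iff_of_pos_right ha).1 hpos
  have := mul_logb_div_add_lt ha hq hm hpos' (by linarith) hL
  rw [one_div_div, ← mul_lt_mul_iff_left₀ ha, sub_mul, mul_right_comm, mul_assoc 3,
    div_mul_cancel₀ _ ha.ne']
  exact this

/-! ### The two conjectures -/

/-- Once `A` is closer to a subcube than the ratio of sizes of different subcubes allows, the
subcube has the size of `A`; for larger `ε` any subcube of the right size will do. -/
theorem exists_subcubeOfCodim_card_le (N : ℕ) {A : Finset (Fin n → Bool)} {ε : ℝ} (hN : N ≤ n)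
    (h0 : 0 ≤ ε) (hcard : #A = 2 ^ (n - N)) (hD : excess A ≤ N * ε * #A) :
    ∃ C, IsSubcubeOfCodim N C ∧ (#(A ∆ C) : ℝ) ≤ 2048 * N * ε * 2 ^ (n - N) := by
  have hA : A.Nonempty := card_pos.1 (by rw [hcard]; positivity)
  have ha : (0 : ℝ) < #A := by exact_mod_cast hA.card_pos
  have hcard' : (#A : ℝ) = 2 ^ (n - N) := by exact_mod_cast hcard
  rw [← hcard']
  have hNε : 0 ≤ N * ε := by positivity
  by_cases hc : N * ε ≤ 1 / 1024
  · obtain ⟨S, z, h⟩ := exists_subcube_card_le hc A hA hD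
    refine ⟨subcube S z, ⟨S, z, ?_, fun _ => mem_subcube⟩, ?_⟩
    · have hεa : N * ε * #A ≤ 1 / 1024 * #A := by gcongr
      have hq : (0 : ℝ) ≤ #(A \ subcube S z) := by positivity
      have hm : (0 : ℝ) ≤ #(subcube S z \ A) := by positivity
      have h1 := cast_card_inter_add_card_sdiff A (subcube S z)
      have h2 := cast_card_inter_add_card_sdiff (subcube S z) A
      rw [inter_comm] at h2
      have h3 : (#(subcube S z) : ℝ) < 2 * #A := by linarith
      have h4 : (#A : ℝ) < 2 * #(subcube S z) := by linarith
      -- two powers of two within a factor less than two of each other are equal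
      have h5 : 2 ^ (n - #S) < 2 ^ (n - N + 1) := by
        rw [pow_succ', ← hcard, ← card_subcube S z]; exact_mod_cast h3
      have h6 : 2 ^ (n - N) < 2 ^ (n - #S + 1) := by
        rw [pow_succ', ← hcard, ← card_subcube S z]; exact_mod_cast h4
      have h7 := (Nat.pow_lt_pow_iff_right one_lt_two).1 h5
      have h8 := (Nat.pow_lt_pow_iff_right one_lt_two).1 h6
      have h9 : #S ≤ n := by simpa using card_le_univ S
      omega
    · rw [card_symmDiff]
      nlinarith
  · obtain ⟨S, -, hS⟩ := exists_subset_card_eq (s := (univ : Finset (Fin n))) (n := N)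
      (by simpa using hN)
    refine ⟨subcube S fun _ => true, ⟨S, _, hS, fun _ => mem_subcube⟩, ?_⟩
    have h1 : (#(A \ subcube S fun _ => true) : ℝ) ≤ #A := by
      exact_mod_cast card_le_card sdiff_subset
    have h2 : (#((subcube S fun _ => true) \ A) : ℝ) ≤ #A := by
      rw [hcard, ← hS, ← card_subcube S fun _ => true]
      exact_mod_cast card_le_card sdiff_subset
    rw [card_symmDiff]
    nlinarith

end Stability

theorem mainTheorem1 :
    -- the stability theorem
    (∃ c : ℝ, 0 < c ∧ ∀ ε : ℝ, ε ≤ c →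
      IsLeast (deltaZeroSolutions ε) (deltaZero ε) ∧
      (0 < ε → deltaZero ε ≤ 2 * ε / Real.logb 2 (1 / ε)) ∧
      ∀ (n : ℕ) (A : Finset (Fin n → Bool)), A.Nonempty →
        ((edgeBoundary A).ncard : ℝ)
          ≤ (A.card : ℝ) * (Real.logb 2 ((2 : ℝ) ^ n / (A.card : ℝ)) + ε) →
        ∃ C : Finset (Fin n → Bool), IsSubcube C ∧
          ((A ∆ C).card : ℝ) < deltaZero ε * (A.card : ℝ)) ∧
    -- the conjecture of Bollobás, Leader and Riordan
    (∀ N : ℕ, ∃ K : ℝ, ∀ (n : ℕ) (A : Finset (Fin n → Bool)) (ε : ℝ), N ≤ n → 0 ≤ ε →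
      A.card = 2 ^ (n - N) →
      ((edgeBoundary A).ncard : ℝ)
        ≤ (1 + ε) * (A.card : ℝ) * Real.logb 2 ((2 : ℝ) ^ n / (A.card : ℝ)) →
      ∃ C : Finset (Fin n → Bool), IsSubcubeOfCodim N C ∧
        ((A ∆ C).card : ℝ) ≤ K * ε * (2 : ℝ) ^ (n - N)) ∧
    -- the conjecture of Samorodnitsky
    (∀ δ : ℝ, 0 < δ → ∃ a : ℝ, 0 < a ∧
      ∀ (n : ℕ) (A : Finset (Fin n → Bool)), 1 ≤ n → A.Nonempty →
        ((edgeBoundary A).ncard : ℝ)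
          ≤ (1 + a / (n : ℝ)) * (A.card : ℝ) * Real.logb 2 ((2 : ℝ) ^ n / (A.card : ℝ)) →
        ∃ C : Finset (Fin n → Bool), IsSubcube C ∧
          ((A ∆ C).card : ℝ) ≤ δ * (A.card : ℝ)) := by
  refine ⟨⟨1 / 1024, by norm_num, fun ε hε => ⟨isLeast_deltaZero hε, fun h0 => ?_,
    fun n A hA h => exists_subcube_card_lt_deltaZero hε hA
      (excess_le_of_ncard_edgeBoundary_le hA h)⟩⟩, fun N => ⟨2048 * N, ?_⟩, fun δ hδ => ?_⟩
  · obtain ⟨x, hx, hle⟩ := exists_mem_deltaZeroSolutions_le h0 hε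
    exact ((isLeast_deltaZero hε).2 hx).trans hle
  · intro n A ε hN h0 hcard h
    have hA : A.Nonempty := Finset.card_pos.1 (by rw [hcard]; positivity)
    refine exists_subcubeOfCodim_card_le N hN h0 hcard
      (excess_le_of_ncard_edgeBoundary_le hA (h.trans_eq ?_))
    have hlog : Real.logb 2 ((2 : ℝ) ^ n / (A.card : ℝ)) = N := by
      have : (2 : ℝ) ^ n / (A.card : ℝ) = 2 ^ N := by
        rw [hcard, div_eq_iff (by positivity)]
        push_cast
        rw [← pow_add, Nat.add_sub_cancel' hN]
      rw [this, Real.logb_pow, Real.logb_self_eq_one (by norm_num), mul_one]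
    rw [hlog]
    ring
  · refine ⟨min (1 / 1024) δ, by positivity, fun n A hn hA h => ?_⟩
    have ha : (1 : ℝ) ≤ A.card := by exact_mod_cast hA.card_pos
    have hn' : (0 : ℝ) < n := by exact_mod_cast hn
    have hlog : Real.logb 2 ((2 : ℝ) ^ n / (A.card : ℝ)) ≤ n := by
      rw [Real.logb_div (by positivity) (by positivity), Real.logb_pow,
        Real.logb_self_eq_one (by norm_num)]
      linarith [Real.logb_nonneg (b := 2) (by norm_num) ha]
    have hD : excess A ≤ min (1 / 1024) δ * A.card := by
      refine excess_le_of_ncard_edgeBoundary_le hA (h.trans ?_)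
      have : min (1 / 1024) δ / n * Real.logb 2 ((2 : ℝ) ^ n / (A.card : ℝ))
          ≤ min (1 / 1024) δ :=
        calc _ ≤ min (1 / 1024) δ / n * n := by gcongr
          _ = min (1 / 1024) δ := by field_simp
      nlinarith
    obtain ⟨S, z, hS⟩ := exists_subcube_card_le (min_le_left _ _) A hA hD
    refine ⟨subcube S z, ⟨_, isSubcubeOfCodim_subcube S z⟩, ?_⟩
    rw [card_symmDiff]
    refine hS.trans ?_
    gcongr
    exact min_le_right _ _
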